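/- Fix a set $\Sigma$ of labels. A graph $G$ consists of a finite set $N_G$ of nodes, a finite set $E_G$ of edges, maps $\mathrm{source}_G,\mathrm{target}_G:E_G\to N_G$, a labelling $\mathrm{lab}_G:E_G\to\Sigma$, and a map $\mathrm{occur}_G$ that assigns to each edge an occurrence interval $[n;m]=\{i\in\mathbb N\mid n\le i\le m\}$ with $n\in\mathbb N$ and $n\le m\le\infty$. Put $\mathrm{out}_G(n)=\{e\in E_G\mid \mathrm{source}_G(e)=n\}$ and $|G|=|N_G|+|E_G|$. Intervals are added by $[n_1;m_1]\oplus[n_2;m_2]=[n_1+n_2;m_1+m_2]$, the empty sum being $[0;0]$. The basic intervals are $1=[1;1]$, $?=[0;1]$, $+=[1;\infty]$, $*=[0;\infty]$. A graph is simple if all its intervals are $1$ and no two distinct edges have the same source, target and label. A shape graph is a graph all of whose intervals are basic; its nodes are also called types. A simulation of $G$ in $H$ is a relation $R\subseteq N_G\times N_H$ such that for every $(n,m)\in R$ there is a function $\lambda:\mathrm{out}_G(n)\to\mathrm{out}_H(m)$ with $\mathrm{lab}_G(e)=\mathrm{lab}_H(\lambda(e))$ and $(\mathrm{target}_G(e),\mathrm{target}_H(\lambda(e)))\in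 R$ for every $e\in\mathrm{out}_G(n)$, and $\bigoplus\{\mathrm{occur}_G(e)\mid e\in\mathrm{out}_G(n),\ \lambda(e)=f\}\subseteq\mathrm{occur}_H(f)$ for every $f\in\mathrm{out}_H(m)$. Write $G\preccurlyeq H$ ($G$ embeds in $H$) if there is a simulation $R$ of $G$ in $H$ such that every node of $G$ is related by $R$ to some node of $H$. Let $L(H)$ be the set of simple graphs $G$ with $G\preccurlyeq H$, and write $H\subseteq K$ if $L(H)\subseteq L(K)$. A reference to a type $t$ of $H$ is an edge $e$ with $\mathrm{target}_H(e)=t$. The $*$-closed references form the least set of edges such that $e$ is $*$-closed whenever $\mathrm{occur}_H(e)=*$, or $\mathrm{source}_H(e)$ is referenced at least once and all references to $\mathrm{source}_H(e)$ are $*$-closed. Let $\mathsf{DetShEx}_0^-$ be the class of shape graphs $H$ such that: every node has at most one outgoing edge with any given label; no edge has interval $+$; and every type with an outgoing edge of interval $?$ is referenced at least once and all references to it are $*$-closed. Then: 1. for all $H,K\in\mathsf{DetShEx}_0^-$, $H\subseteq K$ if and only if $H\preccurlyeq K$; 2. there is a polynomial $P$ such that for every $H\in\mathsf{DetShEx}_0^-$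 there is a simple graph $G\in L(H)$ with $|G|\le P(|H|)$ such that for every $K\in\mathsf{DetShEx}_0^-$, $G\preccurlyeq K$ implies $H\preccurlyeq K$. -/

import Mathlib

universe u v

/-- An occurrence interval `[lo; hi]` with `lo ≤ hi ≤ ∞`. -/
@[ext]
structure OccInterval where
  lo : ℕ
  hi : ℕ∞
  lo_le_hi : (lo : ℕ∞) ≤ hi

namespace OccInterval

/-- The set of natural numbers that the interval represents. -/
def toSet (I : OccInterval) : Set ℕ := {i | I.lo ≤ i ∧ (i : ℕ∞) ≤ I.hi}

/-- The interval `0 = [0; 0]`. -/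
instance : Zero OccInterval := ⟨⟨0, 0, le_rfl⟩⟩

/-- `[n₁; m₁] ⊕ [n₂; m₂] = [n₁ + n₂; m₁ + m₂]`. -/
instance : Add OccInterval :=
  ⟨fun I J => ⟨I.lo + J.lo, I.hi + J.hi, by
    push_cast
    exact add_le_add I.lo_le_hi J.lo_le_hi⟩⟩

@[simp] theorem zero_lo : (0 : OccInterval).lo = 0 := rfl
@[simp] theorem zero_hi : (0 : OccInterval).hi = 0 := rfl
@[simp] theorem add_lo (I J : OccInterval) : (I + J).lo = I.lo + J.lo := rfl
@[simp] theorem add_hi (I J : OccInterval) : (I + J).hi = I.hi + J.hi := rfl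

/-- Intervals form a commutative monoid under `⊕`, so that finite sums (with the empty sum equal
to `[0; 0]`) make sense. -/
instance : AddCommMonoid OccInterval where
  add_assoc I J K := by ext <;> simp [add_assoc]
  zero_add I := by ext <;> simp
  add_zero I := by ext <;> simp
  add_comm I J := by ext <;> simp [add_comm]
  nsmul := nsmulRec

/-- The basic interval `1 = [1; 1]`. -/
def one : OccInterval := ⟨1, 1, by simp⟩
/-- The basic interval `? = [0; 1]`. -/
def opt : OccInterval := ⟨0, 1, by simp⟩
/-- The basic interval `+ = [1; ∞]`. -/
def plus : OccInterval := ⟨1, ⊤, le_top⟩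
/-- The basic interval `* = [0; ∞]`. -/
def star : OccInterval := ⟨0, ⊤, le_top⟩

/-- The four basic intervals. -/
def IsBasic (I : OccInterval) : Prop := I = one ∨ I = opt ∨ I = plus ∨ I = star

end OccInterval

/-- Finite directed multigraphs whose edges carry a label in `Lab` and an occurrence interval. -/
structure OccGraph (Lab : Type u) where
  N : Type v
  E : Type v
  [fintypeN : Fintype N]
  [fintypeE : Fintype E]
  source : E → N
  target : E → N
  lab : E → Lab
  occur : E → OccInterval

namespace OccGraph

variable {Lab : Type u}

instance (G : OccGraph.{u, v} Lab) : Fintype G.N := G.fintypeN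
instance (G : OccGraph.{u, v} Lab) : Fintype G.E := G.fintypeE

/-- The number of nodes plus the number of edges. -/
def size (G : OccGraph.{u, v} Lab) : ℕ := Fintype.card G.N + Fintype.card G.E

/-- Simple graphs: only the interval `1`, and no two edges with the same origin, end point
and label. -/
def IsSimple (G : OccGraph.{u, v} Lab) : Prop :=
  (∀ e, G.occur e = OccInterval.one) ∧
  ∀ e e', G.source e = G.source e' → G.target e = G.target e' → G.lab e = G.lab e' → e = e'

/-- Shape graphs: only basic intervals. -/
def IsShapeGraph (G : OccGraph.{u, v} Lab) : Prop := ∀ e, (G.occur e).IsBasic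

/-- The outgoing edges of a node. -/
abbrev Out (G : OccGraph.{u, v} Lab) (n : G.N) : Type v := {e : G.E // G.source e = n}

noncomputable instance (G : OccGraph.{u, v} Lab) (n : G.N) : Fintype (G.Out n) :=
  Fintype.ofFinite _

open Classical in
/-- `w` is a witness of simulation of `n` by `m` with respect to `R`. -/
def IsWitness (G H : OccGraph.{u, v} Lab) (R : G.N → H.N → Prop) (n : G.N) (m : H.N)
    (w : G.Out n → H.Out m) : Prop :=
  (∀ e : G.Out n, G.lab e.1 = H.lab (w e).1 ∧ R (G.target e.1) (H.target (w e).1)) ∧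
  ∀ f : H.Out m,
    (∑ e ∈ Finset.univ.filter (fun e : G.Out n => w e = f), G.occur e.1).toSet
      ⊆ (H.occur f.1).toSet

/-- `R` is a simulation of `G` in `H`. -/
def IsSimulation (G H : OccGraph.{u, v} Lab) (R : G.N → H.N → Prop) : Prop :=
  ∀ n m, R n m → ∃ w : G.Out n → H.Out m, IsWitness G H R n m w

/-- `G ≼ H`: there is an embedding of `G` in `H`, that is, a simulation whose domain is the
set of all nodes of `G`. -/
def Embeds (G H : OccGraph.{u, v} Lab) : Prop :=
  ∃ R : G.N → H.N → Prop, IsSimulation G H R ∧ ∀ n, ∃ m, R n m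

/-- The language of a graph: the simple graphs that embed in it. -/
def language (H : OccGraph.{u, v} Lab) : Set (OccGraph.{u, v} Lab) :=
  {G | G.IsSimple ∧ G.Embeds H}

/-- Containment `H ⊆ K` is inclusion of languages. -/
def Contained (H K : OccGraph.{u, v} Lab) : Prop := H.language ⊆ K.language

/-- Every node has at most one outgoing edge with a given label. -/
def IsDeterministic (H : OccGraph.{u, v} Lab) : Prop :=
  ∀ e e', H.source e = H.source e' → H.lab e = H.lab e' → e = e'

/-- `e` is a reference to `t`. -/
def IsReference (H : OccGraph.{u, v} Lab) (e : H.E) (t : H.N) : Prop := H.target e = t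

/-- A reference is `*`-closed if it is a `*`-edge, or its origin is referenced and all references
to its origin are `*`-closed (the least such predicate). -/
inductive StarClosed (H : OccGraph.{u, v} Lab) : H.E → Prop
  | of_star (e : H.E) (h : H.occur e = OccInterval.star) : StarClosed H e
  | of_refs (e : H.E) (hne : ∃ e', H.IsReference e' (H.source e))
      (h : ∀ e', H.IsReference e' (H.source e) → StarClosed H e') : StarClosed H e

/-- Type `t` uses the interval `I`. -/
def Uses (H : OccGraph.{u, v} Lab) (t : H.N) (I : OccInterval) : Prop :=
  ∃ e, H.source e = t ∧ H.occur e = I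

/-- The class `DetShEx₀⁻`: deterministic shape graphs that do not use `+` and in which every type
using `?` is referenced at least once and all references to it are `*`-closed. -/
structure IsDetShExMinus (H : OccGraph.{u, v} Lab) : Prop where
  shape : H.IsShapeGraph
  det : H.IsDeterministic
  no_plus : ∀ e, H.occur e ≠ OccInterval.plus
  opt_closed : ∀ t, H.Uses t OccInterval.opt →
    (∃ e, H.IsReference e t) ∧ ∀ e, H.IsReference e t → H.StarClosed e

end OccGraph

/-! Embeddings compose, so an embedding of `H` in `K` transfers languages. Conversely, `unfolding`
is a simple graph of polynomial size in the language of `H`, and any embedding of it in `K` yields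
one of `H`. Copy 0 of a type has no edge for a `?`-edge, which forces lower bound 0 in `K`, and at
least two for a `*`-edge, which forces `*`.

The difficulty is that copies of one type may be simulated by different types of `K`. As `K` is
deterministic, a `*`-edge, reaching all copies of its target from a single node, gives them a common
simulating type, and this agreement passes along further edges. A `?`-edge loses the top index, so
agreement is only required up to `closedHeight`, which drops along non-`*` edges between closed
types (`exists_linked`). Other types have height 0, so only copy 0 counts. -/

namespace OccInterval

/-! ### Inclusions and sums of intervals -/

theorem toSet_subset_iff {I J : OccInterval} :
    I.toSet ⊆ J.toSet ↔ J.lo ≤ I.lo ∧ I.hi ≤ J.hi := by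
  constructor
  · intro h
    refine ⟨(h (show I.lo ∈ I.toSet from ⟨le_rfl, I.lo_le_hi⟩)).1, ?_⟩
    refine ENat.forall_natCast_le_iff_le.mp fun m hm => ?_
    -- `m` itself may lie below `I.lo`, outside the interval.
    have hmax : max m I.lo ∈ I.toSet := by
      refine ⟨le_max_right _ _, ?_⟩
      rcases max_choice m I.lo with h' | h' <;> rw [h']
      · exact hm
      · exact I.lo_le_hi
    exact le_trans (by exact_mod_cast le_max_left m I.lo) (h hmax).2
  · rintro ⟨h₁, h₂⟩ i ⟨hi₁, hi₂⟩
    exact ⟨h₁.trans hi₁, hi₂.trans h₂⟩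

theorem sum_lo {ι : Type*} (s : Finset ι) (f : ι → OccInterval) :
    (∑ i ∈ s, f i).lo = ∑ i ∈ s, (f i).lo :=
  map_sum (⟨⟨OccInterval.lo, rfl⟩, fun _ _ => rfl⟩ : OccInterval →+ ℕ) f s

theorem sum_hi {ι : Type*} (s : Finset ι) (f : ι → OccInterval) :
    (∑ i ∈ s, f i).hi = ∑ i ∈ s, (f i).hi :=
  map_sum (⟨⟨OccInterval.hi, rfl⟩, fun _ _ => rfl⟩ : OccInterval →+ ℕ∞) f s

theorem sum_toSet_subset {ι : Type*} {s : Finset ι} {f g : ι → OccInterval}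
    (h : ∀ i ∈ s, (f i).toSet ⊆ (g i).toSet) :
    (∑ i ∈ s, f i).toSet ⊆ (∑ i ∈ s, g i).toSet := by
  simp only [toSet_subset_iff, sum_lo, sum_hi] at h ⊢
  exact ⟨Finset.sum_le_sum fun i hi => (h i hi).1, Finset.sum_le_sum fun i hi => (h i hi).2⟩

/-- A sum of copies of `1` is the singleton interval of the number of summands. -/
theorem sum_one_toSet_subset_iff {ι : Type*} {s : Finset ι} {f : ι → OccInterval}
    (h : ∀ i ∈ s, f i = one) {J : OccInterval} :
    (∑ i ∈ s, f i).toSet ⊆ J.toSet ↔ J.lo ≤ s.card ∧ (s.card : ℕ∞) ≤ J.hi := by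
  rw [Finset.sum_congr rfl h, toSet_subset_iff, sum_lo, sum_hi]
  simp [one]

theorem IsBasic.lo_le_one {I : OccInterval} (h : I.IsBasic) : I.lo ≤ 1 := by
  rcases h with rfl | rfl | rfl | rfl <;> simp [one, opt, plus, star]

theorem IsBasic.one_le_hi {I : OccInterval} (h : I.IsBasic) : 1 ≤ I.hi := by
  rcases h with rfl | rfl | rfl | rfl <;> simp [one, opt, plus, star]

theorem IsBasic.eq_star {I : OccInterval} (h : I.IsBasic) (hp : I ≠ plus) (h2 : 2 ≤ I.hi) :
    I = star := by
  rcases h with rfl | rfl | rfl | rfl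
  · exact absurd h2 (by simp [one])
  · exact absurd h2 (by simp [opt])
  · exact absurd rfl hp
  · rfl

theorem star_ne_one : star ≠ one := fun h => by simpa [star, one] using congrArg lo h

theorem star_ne_opt : star ≠ opt := fun h => by simpa [star, opt] using congrArg hi h

theorem opt_ne_one : opt ≠ one := fun h => by simpa [opt, one] using congrArg lo h

end OccInterval

namespace OccGraph

variable {Lab : Type u}

/-! ### Composition of embeddings -/

theorem Embeds.trans {G H K : OccGraph.{u, v} Lab} (hGH : G.Embeds H) (hHK : H.Embeds K) :
    G.Embeds K := by
  classical
  obtain ⟨R, hR, hRn⟩ := hGH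
  obtain ⟨S, hS, hSn⟩ := hHK
  refine ⟨fun n m => ∃ t, R n t ∧ S t m, ?_, fun n => ?_⟩
  · rintro n m ⟨t, hnt, htm⟩
    obtain ⟨w, hw, hw'⟩ := hR n t hnt
    obtain ⟨x, hx, hx'⟩ := hS t m htm
    refine ⟨fun e => x (w e), fun e => ⟨(hw e).1.trans (hx (w e)).1, _, (hw e).2, (hx (w e)).2⟩,
      fun f => ?_⟩
    refine subset_trans ?_ (hx' f)
    -- Group the edges sent to `f` by their intermediate edge in `H`.
    rw [← Finset.sum_fiberwise_of_maps_to
      (s := Finset.univ.filter fun e => x (w e) = f) (t := Finset.univ.filter fun g => x g = f)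
      (g := w) (by simp)]
    refine OccInterval.sum_toSet_subset fun g hg => ?_
    refine subset_trans (subset_of_eq ?_) (hw' g)
    congr 2
    ext e
    simp only [Finset.mem_filter, Finset.mem_univ, true_and] at hg ⊢
    exact ⟨fun h => h.2, fun h => ⟨h ▸ hg, h⟩⟩
  · obtain ⟨t, ht⟩ := hRn n
    obtain ⟨m, hm⟩ := hSn t
    exact ⟨m, t, ht, hm⟩

theorem IsDeterministic.out_ext {H : OccGraph.{u, v} Lab} (h : H.IsDeterministic) {t : H.N}
    {e f : H.Out t} (hl : H.lab e.1 = H.lab f.1) : e = f :=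
  Subtype.ext (h _ _ (e.2.trans f.2.symm) hl)

/-! ### Closed types and their height -/

/-- A type all of whose references are `*`-closed, and which is referenced at least once. -/
def ClosedType (H : OccGraph.{u, v} Lab) (t : H.N) : Prop :=
  (∃ e, H.IsReference e t) ∧ ∀ e, H.IsReference e t → H.StarClosed e

/-- Edges between closed types whose interval is not `*`. -/
def ClosedStep (H : OccGraph.{u, v} Lab) (s t : H.N) : Prop :=
  H.ClosedType s ∧ H.ClosedType t ∧
    ∃ e, H.source e = s ∧ H.target e = t ∧ H.occur e ≠ OccInterval.star

theorem StarClosed.closedType_source {H : OccGraph.{u, v} Lab} {e : H.E} (h : H.StarClosed e)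
    (hs : H.occur e ≠ OccInterval.star) : H.ClosedType (H.source e) := by
  cases h with
  | of_star _ h => exact absurd h hs
  | of_refs _ hne h => exact ⟨hne, h⟩

/-- Since `StarClosed` is a least predicate, tracing non-`*` references backwards follows its
derivation and must stop. -/
theorem StarClosed.acc_source {H : OccGraph.{u, v} Lab} {e : H.E} (h : H.StarClosed e) :
    H.occur e ≠ OccInterval.star → Acc H.ClosedStep (H.source e) := by
  induction h with
  | of_star e h => exact fun hs => absurd h hs
  | of_refs e _ _ ih =>
    intro _
    constructor
    rintro _ ⟨-, -, e', rfl, ht, hs⟩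
    exact ih e' ht hs

theorem closedStep_wellFounded (H : OccGraph.{u, v} Lab) : WellFounded H.ClosedStep := by
  refine ⟨fun t => ⟨_, ?_⟩⟩
  rintro _ ⟨-, ht, e, rfl, he, hs⟩
  exact (ht.2 e he).acc_source hs

open Classical in
/-- The number of closed types reachable from `t` through closed types by edges whose interval is
not `*`. It vanishes if `t` is not closed. -/
noncomputable def closedHeight (H : OccGraph.{u, v} Lab) (t : H.N) : ℕ :=
  (Finset.univ.filter fun s => H.ClosedType s ∧ Relation.ReflTransGen H.ClosedStep t s).card

theorem closedHeight_le (H : OccGraph.{u, v} Lab) (t : H.N) :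
    H.closedHeight t ≤ Fintype.card H.N :=
  Finset.card_le_univ _

theorem ClosedType.one_le_closedHeight {H : OccGraph.{u, v} Lab} {t : H.N} (h : H.ClosedType t) :
    1 ≤ H.closedHeight t := by
  classical
  exact Finset.card_pos.mpr ⟨t, by simp [h, Relation.ReflTransGen.refl]⟩

theorem closedHeight_eq_zero {H : OccGraph.{u, v} Lab} {t : H.N} (h : ¬ H.ClosedType t) :
    H.closedHeight t = 0 := by
  classical
  refine Finset.card_eq_zero.mpr (Finset.filter_eq_empty_iff.mpr ?_)
  rintro s - ⟨hs, hts⟩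
  rcases hts.cases_head with rfl | ⟨_, hstep, -⟩
  · exact h hs
  · exact h hstep.1

/-- Everything reachable from `t` is reachable from `s`, while `s` is not reachable from `t`:
well-foundedness excludes cycles. -/
theorem ClosedStep.closedHeight_lt {H : OccGraph.{u, v} Lab} {s t : H.N}
    (h : H.ClosedStep s t) : H.closedHeight t < H.closedHeight s := by
  refine Finset.card_lt_card ((Finset.ssubset_iff_of_subset ?_).mpr ⟨s, ?_, ?_⟩)
  · intro r
    simp only [Finset.mem_filter, Finset.mem_univ, true_and]
    exact fun hr => ⟨hr.1, hr.2.head h⟩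
  · simp [h.1, Relation.ReflTransGen.refl]
  · simp only [Finset.mem_filter, Finset.mem_univ, true_and, not_and]
    exact fun _ hts => (H.closedStep_wellFounded.transGen).irrefl.irrefl s
      (Relation.TransGen.head' h hts)

/-! ### The unfolding -/

/-- Which copies of the target of an edge with interval `I` are reached from which copies of its
source in the unfolding of a shape graph. -/
def Linked (I : OccInterval) (i j : ℕ) : Prop :=
  (I = OccInterval.one → i = j) ∧ (I = OccInterval.opt → i = j + 1)

theorem linked_star (i j : ℕ) : Linked OccInterval.star i j :=
  ⟨fun h => absurd h OccInterval.star_ne_one, fun h => absurd h OccInterval.star_ne_opt⟩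

theorem IsDetShExMinus.occur_cases {H : OccGraph.{u, v} Lab} (hH : H.IsDetShExMinus) (e : H.E) :
    H.occur e = OccInterval.one ∨ H.occur e = OccInterval.opt ∨
      H.occur e = OccInterval.star := by
  rcases hH.shape e with h | h | h | h
  · exact Or.inl h
  · exact Or.inr (Or.inl h)
  · exact absurd h (hH.no_plus e)
  · exact Or.inr (Or.inr h)

/-- The strict drop in height leaves room for the index shift of a `?`-edge. If the source is not
closed and the edge is not `*`, the target is not closed either, and `opt_closed` rules out `?`. -/
theorem IsDetShExMinus.exists_linked {H : OccGraph.{u, v} Lab} (hH : H.IsDetShExMinus) (e : H.E)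
    {j : ℕ} (hj : j ≤ H.closedHeight (H.target e)) :
    ∃ i ≤ H.closedHeight (H.source e), Linked (H.occur e) i j := by
  by_cases hstar : H.occur e = OccInterval.star
  · exact ⟨0, Nat.zero_le _, hstar ▸ linked_star 0 j⟩
  by_cases hs : H.ClosedType (H.source e)
  · have hlt : H.closedHeight (H.target e) < H.closedHeight (H.source e) := by
      by_cases ht : H.ClosedType (H.target e)
      · exact ClosedStep.closedHeight_lt ⟨hs, ht, e, rfl, rfl, hstar⟩
      · rw [closedHeight_eq_zero ht]
        exact hs.one_le_closedHeight
    rcases hH.occur_cases e with h | h | h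
    · exact ⟨j, by omega, fun _ => rfl, fun h' => absurd (h'.symm.trans h) OccInterval.opt_ne_one⟩
    · exact ⟨j + 1, by omega, fun h' => absurd (h.symm.trans h') OccInterval.opt_ne_one,
        fun _ => rfl⟩
    · exact absurd h hstar
  · have ht : ¬ H.ClosedType (H.target e) := fun ht =>
      hs ((ht.2 e rfl).closedType_source hstar)
    rw [closedHeight_eq_zero ht] at hj
    refine ⟨0, Nat.zero_le _, fun _ => by omega, fun h => absurd (hH.opt_closed _ ⟨e, rfl, h⟩) hs⟩

open Classical in
/-- The characterizing simple graph of a shape graph: every type has `|N_H| + 1` copies; a `1`-edge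
joins copies of equal index, a `?`-edge goes from each copy but the last to the preceding one, and
a `*`-edge joins all copies. -/
noncomputable def unfolding (H : OccGraph.{u, v} Lab) : OccGraph.{u, v} Lab where
  N := H.N × Fin (Fintype.card H.N + 1)
  E := {p : H.E × Fin (Fintype.card H.N + 1) × Fin (Fintype.card H.N + 1) //
    Linked (H.occur p.1) p.2.1 p.2.2}
  source p := (H.source p.1.1, p.1.2.1)
  target p := (H.target p.1.1, p.1.2.2)
  lab p := H.lab p.1.1
  occur _ := OccInterval.one

theorem IsDeterministic.unfolding_isSimple {H : OccGraph.{u, v} Lab} (hH : H.IsDeterministic) :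
    H.unfolding.IsSimple := by
  refine ⟨fun _ => rfl, ?_⟩
  rintro ⟨⟨e, i, j⟩, h⟩ ⟨⟨e', i', j'⟩, h'⟩ hs ht hl
  obtain ⟨hs, rfl⟩ := Prod.mk.inj hs
  obtain ⟨-, rfl⟩ := Prod.mk.inj ht
  obtain rfl := hH e e' hs hl
  rfl

theorem IsDetShExMinus.unfolding_embeds {H : OccGraph.{u, v} Lab} (hH : H.IsDetShExMinus) :
    H.unfolding.Embeds H := by
  classical
  refine ⟨fun n t => n.1 = t, ?_, fun n => ⟨n.1, rfl⟩⟩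
  rintro ⟨t, i⟩ m (rfl : t = m)
  refine ⟨fun x => ⟨x.1.1.1, (Prod.mk.inj x.2).1⟩, fun x => ⟨rfl, rfl⟩, fun (f : H.Out t) => ?_⟩
  refine (OccInterval.sum_one_toSet_subset_iff fun _ _ => rfl).mpr ?_
  obtain ⟨f, rfl⟩ := f
  have hcopy : ∀ x : H.unfolding.Out (H.source f, i), x.1.1.2.1 = i := fun x =>
    (Prod.mk.inj x.2).2
  have hle : H.occur f ≠ OccInterval.star → ∀ s : Finset (H.unfolding.Out (H.source f, i)),
      (∀ x ∈ s, x.1.1.1 = f) → (s.card : ℕ∞) ≤ 1 := by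
    intro hstar s hs
    refine (Nat.cast_le.mpr (Finset.card_le_one.mpr fun x hx y hy => ?_)).trans Nat.cast_one.le
    replace hx := hs x hx
    replace hy := hs y hy
    have hxl := x.1.2
    have hyl := y.1.2
    have hxi := hcopy x
    have hyi := hcopy y
    refine Subtype.ext (Subtype.ext (Prod.ext (hx.trans hy.symm)
      (Prod.ext (hxi.trans hyi.symm) ?_)))
    rw [hx, hxi] at hxl
    rw [hy, hyi] at hyl
    refine Fin.ext ?_
    rcases hH.occur_cases f with h | h | h
    · exact (hxl.1 h).symm.trans (hyl.1 h)
    · exact Nat.succ_injective ((hxl.2 h).symm.trans (hyl.2 h))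
    · exact absurd h hstar
  rcases hH.occur_cases f with h | h | h
  · refine ⟨?_, ?_⟩
    · rw [h]
      refine Finset.card_pos.mpr ⟨⟨⟨(f, i, i), fun _ => rfl, fun h' =>
        absurd (h'.symm.trans h) OccInterval.opt_ne_one⟩, rfl⟩, ?_⟩
      simp
    · rw [h]
      exact hle (h ▸ OccInterval.star_ne_one.symm) _ fun x hx =>
        congrArg Subtype.val (Finset.mem_filter.mp hx).2
  · refine ⟨by rw [h]; exact Nat.zero_le _, ?_⟩
    rw [h]
    exact hle (h ▸ OccInterval.star_ne_opt.symm) _ fun x hx =>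
      congrArg Subtype.val (Finset.mem_filter.mp hx).2
  · rw [h]
    exact ⟨Nat.zero_le _, le_top⟩

theorem size_unfolding_le (H : OccGraph.{u, v} Lab) :
    H.unfolding.size ≤ H.size * (H.size + 1) + H.size * (H.size + 1) ^ 2 := by
  classical
  have hN : Fintype.card H.unfolding.N = Fintype.card H.N * (Fintype.card H.N + 1) := by
    rw [← Nat.card_eq_fintype_card]
    exact (Nat.card_prod _ _).trans (by simp)
  have hE : Fintype.card H.unfolding.E ≤ Fintype.card H.E * (Fintype.card H.N + 1) ^ 2 := by
    rw [← Nat.card_eq_fintype_card]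
    refine (Finite.card_subtype_le _).trans (le_of_eq ?_)
    simp [sq]
  have hNs : Fintype.card H.N ≤ H.size := Nat.le_add_right _ _
  have hEs : Fintype.card H.E ≤ H.size := Nat.le_add_left _ _
  unfold size at hNs hEs ⊢
  rw [hN]
  refine add_le_add (by gcongr) (hE.trans (by gcongr))

/-! ### Recovering an embedding of the shape graph -/

theorem IsDetShExMinus.embeds_of_unfolding_embeds {H K : OccGraph.{u, v} Lab}
    (hH : H.IsDetShExMinus) (hK : K.IsDetShExMinus) (h : H.unfolding.Embeds K) : H.Embeds K := by
  classical
  obtain ⟨S, hS, hSn⟩ := h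
  let R : H.N → K.N → Prop := fun t m =>
    ∀ i : Fin (Fintype.card H.N + 1), (i : ℕ) ≤ H.closedHeight t → S (t, i) m
  have hmem : ∀ t m (i : Fin (Fintype.card H.N + 1)), S (t, i) m → ∀ e : H.Out t,
      ∀ j : Fin (Fintype.card H.N + 1), Linked (H.occur e.1) i j →
      ∃ f : K.Out m, H.lab e.1 = K.lab f.1 ∧ S (H.target e.1, j) (K.target f.1) := by
    rintro _ m i hS' ⟨e, rfl⟩ j hl
    obtain ⟨w, hw, -⟩ := hS _ _ hS'
    exact ⟨_, hw ⟨⟨(e, i, j), hl⟩, rfl⟩⟩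
  have hedge : ∀ t m, R t m → ∀ e : H.Out t, ∃ f : K.Out m,
      H.lab e.1 = K.lab f.1 ∧ R (H.target e.1) (K.target f.1) := by
    rintro t m hR ⟨e, rfl⟩
    have key : ∀ j : Fin (Fintype.card H.N + 1), (j : ℕ) ≤ H.closedHeight (H.target e) →
        ∃ f : K.Out m, H.lab e = K.lab f.1 ∧ S (H.target e, j) (K.target f.1) := by
      intro j hj
      obtain ⟨i, hi, hl⟩ := hH.exists_linked e hj
      have hlt : i < Fintype.card H.N + 1 := Nat.lt_succ_of_le (hi.trans (H.closedHeight_le _))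
      exact hmem _ m ⟨i, hlt⟩ (hR ⟨i, hlt⟩ hi) ⟨e, rfl⟩ j hl
    -- Copy 0 selects the edge of `K`; determinism identifies the choices of the other copies with
    -- it.
    obtain ⟨f, hf, -⟩ := key 0 (Nat.zero_le _)
    refine ⟨f, hf, fun j hj => ?_⟩
    obtain ⟨f', hf', hS'⟩ := key j hj
    rwa [hK.det.out_ext (hf'.symm.trans hf)] at hS'
  have hzero : ∀ t m, R t m → S (t, 0) m := fun t m hR => hR 0 (Nat.zero_le _)
  refine ⟨R, ?_, ?_⟩
  · intro t m hR
    choose w hw using hedge t m hR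
    refine ⟨w, hw, fun f => ?_⟩
    -- The out-edges of copy 0 alone suffice for the interval conditions.
    obtain ⟨w₀, hw₀, hw₀'⟩ := hS _ _ (hzero t m hR)
    have hcount := (OccInterval.sum_one_toSet_subset_iff fun _ _ => rfl).mp (hw₀' f)
    have hlo : (∀ x, w₀ x ≠ f) → (K.occur f.1).lo = 0 := by
      intro hx
      rw [Finset.filter_eq_empty_iff.mpr fun x _ => hx x] at hcount
      exact Nat.le_zero.mp hcount.1
    rw [OccInterval.toSet_subset_iff]
    by_cases hf : ∃ e, w e = f
    · obtain ⟨e, rfl⟩ := hf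
      have hfilter : (Finset.univ.filter fun e' => w e' = w e) = {e} := by
        ext e'
        simp only [Finset.mem_filter, Finset.mem_univ, true_and, Finset.mem_singleton]
        refine ⟨fun h => hH.det.out_ext ?_, fun h => h ▸ rfl⟩
        rw [(hw e').1, h, (hw e).1]
      rw [hfilter, Finset.sum_singleton]
      have hb := hK.shape (w e).1
      rcases hH.occur_cases e.1 with h | h | h
      · rw [h]
        exact ⟨hb.lo_le_one, hb.one_le_hi⟩
      · rw [h]
        refine ⟨le_of_eq (hlo fun x hx => ?_), hb.one_le_hi⟩
        have hxe : x.1.1.1 = e.1 := by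
          refine hH.det _ _ ((Prod.mk.inj x.2).1.trans e.2.symm) ?_
          rw [(hw e).1, ← hx]
          exact (hw₀ x).1
        have hxl := x.1.2.2 (hxe ▸ h)
        rw [(Prod.mk.inj x.2).2] at hxl
        exact absurd hxl (Nat.succ_ne_zero _).symm
      · have hstar : K.occur (w e).1 = OccInterval.star := by
          refine hb.eq_star (hK.no_plus _) (le_trans ?_ hcount.2)
          -- As `t` exists there are at least two copies, hence two edges from copy 0 counted
          -- against `w e`.
          have hcard : 1 < Fintype.card H.N + 1 :=
            Nat.succ_lt_succ (Fintype.card_pos_iff.mpr ⟨t⟩)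
          let x : Fin (Fintype.card H.N + 1) → H.unfolding.Out (t, 0) := fun j =>
            ⟨⟨(e.1, 0, j), h ▸ linked_star _ _⟩, Prod.ext e.2 rfl⟩
          have hx : ∀ j, w₀ (x j) = w e := fun j =>
            hK.det.out_ext ((hw₀ (x j)).1.symm.trans (hw e).1)
          refine (Nat.cast_le (α := ℕ∞) (m := 2)).mpr (Finset.one_lt_card.mpr
            ⟨x 0, by simp [hx], x ⟨1, hcard⟩, by simp [hx], fun heq => ?_⟩)
          have : (0 : Fin (Fintype.card H.N + 1)) = ⟨1, hcard⟩ :=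
            congrArg (fun y : H.unfolding.Out (t, 0) => y.1.1.2.2) heq
          exact absurd (congrArg Fin.val this) (by simp)
        rw [h, hstar]
        exact ⟨le_rfl, le_rfl⟩
    · push Not at hf
      rw [Finset.filter_eq_empty_iff.mpr fun e _ => hf e, Finset.sum_empty]
      refine ⟨le_of_eq (hlo fun x hx => ?_), zero_le⟩
      refine hf ⟨x.1.1.1, (Prod.mk.inj x.2).1⟩ (hK.det.out_ext ?_)
      rw [← (hw _).1, ← hx]
      exact (hw₀ x).1
  -- Agreement of copies starts at a `*`-edge and is carried by `hedge` along the derivation of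
  -- `*`-closedness.
  · have hclosed : ∀ e, H.StarClosed e → ∃ m, R (H.target e) m := by
      intro e he
      induction he with
      | of_star e hstar =>
        obtain ⟨m, hm⟩ := hSn (H.source e, 0)
        have key := fun j => hmem _ m 0 hm ⟨e, rfl⟩ j (hstar ▸ linked_star _ _)
        obtain ⟨f, hf, -⟩ := key 0
        refine ⟨K.target f.1, fun j _ => ?_⟩
        obtain ⟨f', hf', hS'⟩ := key j
        rwa [hK.det.out_ext (hf'.symm.trans hf)] at hS'
      | of_refs e hne _ ih =>
        obtain ⟨e', he'⟩ := hne
        obtain ⟨m, hm⟩ := ih e' he'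
        rw [he'] at hm
        obtain ⟨f, -, hf⟩ := hedge _ m hm ⟨e, rfl⟩
        exact ⟨_, hf⟩
    intro t
    by_cases ht : H.ClosedType t
    · obtain ⟨⟨e, rfl⟩, h⟩ := ht
      exact hclosed e (h e rfl)
    · obtain ⟨m, hm⟩ := hSn (t, 0)
      refine ⟨m, fun i hi => ?_⟩
      rw [closedHeight_eq_zero ht] at hi
      obtain rfl : i = 0 := Fin.ext (Nat.le_zero.mp hi)
      exact hm

theorem IsDetShExMinus.unfolding_mem_language {H : OccGraph.{u, v} Lab} (hH : H.IsDetShExMinus) :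
    H.unfolding ∈ H.language :=
  ⟨hH.det.unfolding_isSimple, hH.unfolding_embeds⟩

end OccGraph

theorem mainTheorem1 {Lab : Type u} :
    (∀ H K : OccGraph.{u, v} Lab, H.IsDetShExMinus → K.IsDetShExMinus →
      (H.Contained K ↔ H.Embeds K)) ∧
    (∃ P : Polynomial ℕ, ∀ H : OccGraph.{u, v} Lab, H.IsDetShExMinus →
      ∃ G : OccGraph.{u, v} Lab, G ∈ H.language ∧ G.size ≤ P.eval H.size ∧
        ∀ K : OccGraph.{u, v} Lab, K.IsDetShExMinus → G.Embeds K → H.Embeds K) := by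
  refine ⟨fun H K hH hK => ⟨fun h => ?_, fun h G hG => ⟨hG.1, hG.2.trans h⟩⟩, ?_⟩
  · exact hH.embeds_of_unfolding_embeds hK (h hH.unfolding_mem_language).2
  · refine ⟨Polynomial.X * (Polynomial.X + 1) + Polynomial.X * (Polynomial.X + 1) ^ 2,
      fun H hH => ⟨H.unfolding, hH.unfolding_mem_language, ?_, fun K hK =>
        hH.embeds_of_unfolding_embeds hK⟩⟩
    simpa using H.size_unfolding_le
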